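/- Let $T\ge 2$, let $p_1,\dots,p_T\in\mathbb{R}_+^m$ be nonzero probe vectors with nonnegative entries, and let $y_1,\dots,y_T\in\mathbb{R}^m$ be (noisy) observed responses. The test statistic $\Phi^*(\mathbf{y})\ge 0$ is the optimal value (infimum) of $\Phi$ over all $\Phi\ge 0$ for which there exist $u_1,\dots,u_T\in\mathbb{R}$ and $\lambda_1,\dots,\lambda_T>0$ with $$u_s-u_t-\lambda_t\,p_t'(y_s-y_t)-\lambda_t\Phi\le 0\qquad\text{for all } s,t\in\{1,\dots,T\}.$$ Let $w_1,\dots,w_T$ be i.i.d. standard Gaussian vectors in $\mathbb{R}^m$ and let $$M=\max_{t\ne s}\,p_t'(w_t-w_s).$$ Then the false-alarm probability $\Pr\{M\ge\Phi^*(\mathbf{y})\}$ of the revealed-preference test (where $\Phi^*(\mathbf{y})$ is computed from the given data $\mathbf{y}$, and the probability is over the noise $w_1,\dots,w_T$ defining $M$) satisfies $$\Pr\{M\ge\Phi^*(\mathbf{y})\}\;\ge\;1-\prod_{t=1}^{T}\left\{1-\sqrt{\frac{2}{\pi}}\;\frac{\sqrt{2\|p_t\|^2}\,\exp\!\left(-\dfrac{\Phi^*(\mathbf{y})^2}{4\|p_t\|^2}\right)}{\Phi^*(\mathbf{y})+\sqrt{\Phi^*(\mathbf{y})^2+8\|p_t\|^2}}\right\},$$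 where $\|\cdot\|$ is the Euclidean norm. -/

import Mathlib

open MeasureTheory ProbabilityTheory

namespace RevealedPreference

/-- Feasibility of the adjustment level `Φ` for the noisy dataset `(p t, y t)`, `t : Fin T`:
`Φ ≥ 0`, and there are utility levels `u t` and multipliers `lam t > 0` which solve the Afriat
inequalities relaxed by `lam t * Φ`. -/
def Feasible {T m : ℕ} (p y : Fin T → EuclideanSpace ℝ (Fin m)) (Φ : ℝ) : Prop :=
  0 ≤ Φ ∧ ∃ u lam : Fin T → ℝ, (∀ t, 0 < lam t) ∧
    ∀ s t, u s - u t - lam t * inner ℝ (p t) (y s - y t) - lam t * Φ ≤ 0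

/-- The test statistic `Φ*(y)`: the optimal value of the problem of minimizing `Φ` over the
feasible adjustment levels. (The constraints `lam t > 0` are strict, so the optimal value need
not be attained; it is the infimum.) -/
noncomputable def testStatistic {T m : ℕ} (p y : Fin T → EuclideanSpace ℝ (Fin m)) : ℝ :=
  sInf {Φ : ℝ | Feasible p y Φ}

/-- The feasible set is nonempty and bounded below, so that the test statistic is its genuine
greatest lower bound. -/
theorem isGLB_testStatistic {T m : ℕ} (p y : Fin T → EuclideanSpace ℝ (Fin m)) :
    IsGLB {Φ : ℝ | Feasible p y Φ} (testStatistic p y) := by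
  refine isGLB_csInf ?_ ⟨0, fun Φ h => h.1⟩
  refine ⟨∑ s, ∑ t, |inner ℝ (p t) (y s - y t)|, by positivity, fun _ => 0, fun _ => 1,
    fun _ => one_pos, fun s t => ?_⟩
  have h1 : |inner ℝ (p t) (y s - y t)| ≤ ∑ t, |inner ℝ (p t) (y s - y t)| :=
    Finset.single_le_sum (f := fun t => |inner ℝ (p t) (y s - y t)|)
      (fun i _ => abs_nonneg _) (Finset.mem_univ t)
  have h2 : ∑ t, |inner ℝ (p t) (y s - y t)| ≤ ∑ s, ∑ t, |inner ℝ (p t) (y s - y t)| :=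
    Finset.single_le_sum (f := fun s => ∑ t, |inner ℝ (p t) (y s - y t)|)
      (fun i _ => Finset.sum_nonneg fun _ _ => abs_nonneg _) (Finset.mem_univ s)
  have h3 := neg_abs_le (inner ℝ (p t) (y s - y t))
  linarith

/-- The value of `M = max_{t ≠ s} p_t' (w_t - w_s)` at the noise vectors `v t`. -/
noncomputable def maxNoise {T m : ℕ} (p v : Fin T → EuclideanSpace ℝ (Fin m)) : ℝ :=
  ⨆ q : {q : Fin T × Fin T // q.1 ≠ q.2}, inner ℝ (p q.1.1) (v q.1.1 - v q.1.2)

/-- For at least two observations, `maxNoise` is a genuine maximum. -/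
theorem isGreatest_maxNoise {T m : ℕ} (hT : 2 ≤ T)
    (p v : Fin T → EuclideanSpace ℝ (Fin m)) :
    IsGreatest {r : ℝ | ∃ t s, t ≠ s ∧ r = inner ℝ (p t) (v t - v s)} (maxNoise p v) := by
  have : Nonempty {q : Fin T × Fin T // q.1 ≠ q.2} :=
    ⟨⟨(⟨0, by omega⟩, ⟨1, by omega⟩), by simp⟩⟩
  constructor
  · obtain ⟨q, hq⟩ := exists_eq_ciSup_of_finite
      (f := fun q : {q : Fin T × Fin T // q.1 ≠ q.2} =>
        (inner ℝ (p q.1.1) (v q.1.1 - v q.1.2) : ℝ))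
    exact ⟨q.1.1, q.1.2, q.2, hq.symm⟩
  · rintro r ⟨t, s, hts, rfl⟩
    exact le_ciSup (f := fun q : {q : Fin T × Fin T // q.1 ≠ q.2} =>
        (inner ℝ (p q.1.1) (v q.1.1 - v q.1.2) : ℝ)) (Set.finite_range _).bddAbove ⟨(t, s), hts⟩

/-- The false-alarm (Type-I error) probability `Pr {M ≥ Φ*(y)}` of the test for the observed
responses `y`: the tail beyond `Φ*(y)` of the law of `M`, for the noise `w` on `(Ω, P)`. -/
noncomputable def falseAlarmProb {Ω : Type*} [MeasurableSpace Ω] (P : Measure Ω) {T m : ℕ}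
    (p : Fin T → EuclideanSpace ℝ (Fin m)) (w : Fin T → Ω → EuclideanSpace ℝ (Fin m))
    (y : Fin T → EuclideanSpace ℝ (Fin m)) : ℝ :=
  P.real {ω | testStatistic p y ≤ maxNoise p (fun t => w t ω)}

end RevealedPreference

/-! Fix a permutation `σ` of the indices without fixed points. Since `M` dominates every `⟪p t, w t
- w (σ t)⟫`, the event `M < Φ*` lies in the intersection of the events `S t` that these variables
are below `Φ*`. By nonnegativity of the probes, raising the vector `w t` makes `S t` harder and `S
(σ⁻¹ t)` easier, and no other event depends on it. Such events are negatively dependent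
(`HarrisInequality.lintegral_pi_prod_le`), so the probability of the intersection is at most the
product of the probabilities. Each variable is centred Gaussian with variance `2‖p t‖²`, and
Birnbaum's lower bound for its tail (`birnbaum_gaussianReal_Ici`) gives the factors. -/

open scoped ENNReal NNReal

/-! ### Association inequalities and negative dependence. -/

/-- Antitone and monotone functions are negatively correlated under `μ`. -/
def HarrisInequality {X : Type*} [MeasurableSpace X] [Preorder X] (μ : Measure X) : Prop :=
  ∀ f g : X → ℝ≥0∞, Measurable f → Measurable g → Antitone f → Monotone g →
    ∫⁻ x, f x * g x ∂μ ≤ (∫⁻ x, f x ∂μ) * ∫⁻ x, g x ∂μ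

/-- Chebyshev's association inequality. -/
theorem harrisInequality_of_linearOrder {X : Type*} [MeasurableSpace X] [LinearOrder X]
    (μ : Measure X) [IsProbabilityMeasure μ] : HarrisInequality μ := by
  intro f g hf hg hfa hgm
  -- This is `(f x - f y) * (g x - g y) ≤ 0` without subtraction, which truncates in `ℝ≥0∞`. It is
  -- integrated over two independent copies of `μ`.
  have key : ∀ x y, f x * g x + f y * g y ≤ f x * g y + f y * g x := by
    intro x y
    rcases le_total x y with h | h
    · obtain ⟨u, hu⟩ := exists_add_of_le (hfa h)
      obtain ⟨v, hv⟩ := exists_add_of_le (hgm h)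
      rw [hu, hv]
      exact le_iff_exists_add.2 ⟨u * v, by ring⟩
    · obtain ⟨u, hu⟩ := exists_add_of_le (hfa h)
      obtain ⟨v, hv⟩ := exists_add_of_le (hgm h)
      rw [hu, hv]
      exact le_iff_exists_add.2 ⟨u * v, by ring⟩
  have h1 : ∫⁻ x, ∫⁻ y, (f x * g x + f y * g y) ∂μ ∂μ
      ≤ ∫⁻ x, ∫⁻ y, (f x * g y + f y * g x) ∂μ ∂μ :=
    lintegral_mono fun x => lintegral_mono fun y => key x y
  have h2 : ∫⁻ x, ∫⁻ y, (f x * g x + f y * g y) ∂μ ∂μ = 2 * ∫⁻ x, f x * g x ∂μ := by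
    have : ∀ x, ∫⁻ y, (f x * g x + f y * g y) ∂μ = f x * g x + ∫⁻ y, f y * g y ∂μ := by
      intro x
      rw [lintegral_add_left measurable_const]
      simp
    simp_rw [this]
    rw [lintegral_add_right _ measurable_const]
    simp [two_mul]
  have h3 : ∫⁻ x, ∫⁻ y, (f x * g y + f y * g x) ∂μ ∂μ
      = 2 * ((∫⁻ x, f x ∂μ) * ∫⁻ x, g x ∂μ) := by
    have : ∀ x, ∫⁻ y, (f x * g y + f y * g x) ∂μ
        = f x * (∫⁻ y, g y ∂μ) + (∫⁻ y, f y ∂μ) * g x := by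
      intro x
      rw [lintegral_add_left (by fun_prop), lintegral_const_mul _ hg, lintegral_mul_const _ hf]
    simp_rw [this]
    rw [lintegral_add_left (by fun_prop), lintegral_mul_const _ hf, lintegral_const_mul _ hg,
      two_mul]
  rw [h2, h3] at h1
  exact (ENNReal.mul_le_mul_iff_right (by norm_num) (by norm_num)).1 h1

/-- One-coordinate case of negative dependence: only the factors `a` and `b` vary, so the others
come out of the integral. -/
theorem HarrisInequality.lintegral_prod_le {X κ : Type*} [MeasurableSpace X] [Preorder X]
    [Fintype κ] {μ : Measure X} [IsProbabilityMeasure μ] (hμ : HarrisInequality μ)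
    (g : κ → X → ℝ≥0∞) (hg : ∀ k, Measurable (g k)) {a b : κ} (hab : a ≠ b)
    (hanti : Antitone (g a)) (hmono : Monotone (g b))
    (hconst : ∀ k, k ≠ a → k ≠ b → ∀ c d, g k c = g k d) :
    ∫⁻ x, ∏ k, g k x ∂μ ≤ ∏ k, ∫⁻ x, g k x ∂μ := by
  classical
  obtain ⟨c⟩ : Nonempty X := nonempty_of_isProbabilityMeasure μ
  have hb : b ∈ Finset.univ.erase a := by simp [hab.symm]
  have hsplit : ∀ F : κ → ℝ≥0∞, ∏ k, F k
      = F a * F b * ∏ k ∈ (Finset.univ.erase a).erase b, F k := by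
    intro F
    rw [mul_assoc, Finset.mul_prod_erase _ _ hb, Finset.mul_prod_erase _ _ (Finset.mem_univ a)]
  have hk : ∀ k ∈ (Finset.univ.erase a).erase b, ∀ x, g k x = g k c := by
    intro k hk x
    simp only [Finset.mem_erase] at hk
    exact hconst k hk.2.1 hk.1 x c
  have h1 : ∀ x, ∏ k, g k x
      = g a x * g b x * ∏ k ∈ (Finset.univ.erase a).erase b, g k c := by
    intro x
    rw [hsplit, Finset.prod_congr rfl fun k h => hk k h x]
  have h2 : ∏ k ∈ (Finset.univ.erase a).erase b, ∫⁻ x, g k x ∂μ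
      = ∏ k ∈ (Finset.univ.erase a).erase b, g k c := by
    refine Finset.prod_congr rfl fun k h => ?_
    simp [lintegral_congr fun x => hk k h x]
  simp_rw [h1]
  rw [hsplit, h2, lintegral_mul_const _ (by fun_prop : Measurable fun x => g a x * g b x)]
  exact mul_le_mul_left (hμ _ _ (hg a) (hg b) hanti hmono) _

theorem piFinSuccAbove_zero_symm_apply {X : Type*} [MeasurableSpace X] {n : ℕ}
    (z : X × (Fin n → X)) :
    (MeasurableEquiv.piFinSuccAbove (fun _ : Fin (n + 1) => X) 0).symm z = Fin.cons z.1 z.2 :=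
  Fin.insertNth_zero' z.1 z.2

theorem measurable_finCons {X : Type*} [MeasurableSpace X] {n : ℕ} :
    Measurable fun z : X × (Fin n → X) => (Fin.cons z.1 z.2 : Fin (n + 1) → X) := by
  simp_rw [← piFinSuccAbove_zero_symm_apply]
  exact MeasurableEquiv.measurable _

theorem lintegral_pi_finSucc {X : Type*} [MeasurableSpace X] (μ : Measure X)
    [IsProbabilityMeasure μ] {n : ℕ} {F : (Fin (n + 1) → X) → ℝ≥0∞} (hF : Measurable F) :
    ∫⁻ x, F x ∂(Measure.pi fun _ => μ)
      = ∫⁻ c, ∫⁻ x, F (Fin.cons c x) ∂(Measure.pi fun _ => μ) ∂μ := by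
  have h := (measurePreserving_piFinSuccAbove (fun _ : Fin (n + 1) => μ) 0).symm
  rw [← h.lintegral_comp hF]
  simp_rw [piFinSuccAbove_zero_symm_apply]
  exact lintegral_prod _ (hF.comp measurable_finCons).aemeasurable

/-- Negative dependence: if each coordinate enters at most two of the functions `f k`, in one of
them decreasingly and in the other one increasingly, then the expectation of the product is at most
the product of the expectations. -/
theorem HarrisInequality.lintegral_pi_prod_le {X κ : Type*} [MeasurableSpace X] [Preorder X]
    [Fintype κ] {μ : Measure X} [IsProbabilityMeasure μ] (hμ : HarrisInequality μ) {n : ℕ}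
    (f : κ → (Fin n → X) → ℝ≥0∞) (hf : ∀ k, Measurable (f k)) (a b : Fin n → κ)
    (hab : ∀ i, a i ≠ b i)
    (hanti : ∀ i x, Antitone fun c => f (a i) (Function.update x i c))
    (hmono : ∀ i x, Monotone fun c => f (b i) (Function.update x i c))
    (hconst : ∀ i k, k ≠ a i → k ≠ b i → ∀ x c, f k (Function.update x i c) = f k x) :
    ∫⁻ x, ∏ k, f k x ∂(Measure.pi fun _ => μ) ≤ ∏ k, ∫⁻ x, f k x ∂(Measure.pi fun _ => μ) := by
  induction n with
  | zero =>
    rw [Measure.pi_of_empty _ isEmptyElim]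
    simp [lintegral_dirac' _ (hf _), lintegral_dirac' _ (Finset.measurable_fun_prod _ fun k _ => hf k)]
  | succ n ih =>
    have hcons : ∀ k, Measurable fun z : X × (Fin n → X) => f k (Fin.cons z.1 z.2) :=
      fun k => (hf k).comp measurable_finCons
    rw [lintegral_pi_finSucc μ (Finset.measurable_prod _ fun k _ => hf k)]
    simp_rw [fun k => lintegral_pi_finSucc μ (hf k)]
    calc ∫⁻ c, ∫⁻ x, ∏ k, f k (Fin.cons c x) ∂(Measure.pi fun _ => μ) ∂μ
        ≤ ∫⁻ c, ∏ k, ∫⁻ x, f k (Fin.cons c x) ∂(Measure.pi fun _ => μ) ∂μ := by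
          -- With the head coordinate frozen, the induction hypothesis handles the tail.
          refine lintegral_mono fun c => ?_
          refine ih (fun k x => f k (Fin.cons c x)) (fun k => (hcons k).comp measurable_prodMk_left)
            (fun i => a i.succ) (fun i => b i.succ) (fun i => hab i.succ) ?_ ?_ ?_
          · intro i x
            simpa only [Fin.cons_update] using hanti i.succ (Fin.cons c x)
          · intro i x
            simpa only [Fin.cons_update] using hmono i.succ (Fin.cons c x)
          · intro i k h1 h2 x d
            simpa only [Fin.cons_update] using hconst i.succ k h1 h2 (Fin.cons c x) d
      _ ≤ ∏ k, ∫⁻ c, ∫⁻ x, f k (Fin.cons c x) ∂(Measure.pi fun _ => μ) ∂μ := by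
          -- Integrating out the tail preserves monotonicity in the head coordinate, so the
          -- one-coordinate case applies.
          refine hμ.lintegral_prod_le _ (fun k => (hcons k).lintegral_prod_right') (hab 0) ?_ ?_ ?_
          · intro c d hcd
            refine lintegral_mono fun x => ?_
            simpa only [Fin.update_cons_zero] using hanti 0 (Fin.cons c x) hcd
          · intro c d hcd
            refine lintegral_mono fun x => ?_
            simpa only [Fin.update_cons_zero] using hmono 0 (Fin.cons c x) hcd
          · intro k h1 h2 c d
            refine lintegral_congr fun x => ?_
            simpa only [Fin.update_cons_zero] using hconst 0 k h1 h2 (Fin.cons d x) c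

/-- **Harris' inequality** for finite product measures. -/
theorem HarrisInequality.pi {X : Type*} [MeasurableSpace X] [Preorder X] {μ : Measure X}
    [IsProbabilityMeasure μ] (hμ : HarrisInequality μ) (n : ℕ) :
    HarrisInequality (Measure.pi fun _ : Fin n => μ) := by
  intro f g hf hg hfa hgm
  -- Two factors, with every coordinate entering `f` decreasingly and `g` increasingly.
  have h := hμ.lintegral_pi_prod_le (fun k : Bool => if k then f else g)
    (by intro k; cases k <;> simpa) (fun _ => true) (fun _ => false) (by simp)
    (by
      intro i x c d hcd
      simpa using hfa (update_le_update_iff.2 ⟨hcd, fun _ _ => le_rfl⟩))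
    (by
      intro i x c d hcd
      simpa using hgm (update_le_update_iff.2 ⟨hcd, fun _ _ => le_rfl⟩))
    (by intro i k; cases k <;> simp)
  simpa using h

/-! ### Birnbaum's lower bound for Gaussian tails. -/

theorem hasDerivAt_exp_mul_sqrt_sub (x : ℝ) :
    HasDerivAt (fun x : ℝ => Real.exp (-x ^ 2 / 2) * (Real.sqrt (x ^ 2 + 4) - x) / 2)
      (-(Real.exp (-x ^ 2 / 2) * ((Real.sqrt (x ^ 2 + 4) - x) / 2)
        * (x + 1 / Real.sqrt (x ^ 2 + 4)))) x := by
  have hs : 0 < Real.sqrt (x ^ 2 + 4) := by positivity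
  have h1 : HasDerivAt (fun x : ℝ => Real.sqrt (x ^ 2 + 4)) (x / Real.sqrt (x ^ 2 + 4)) x := by
    have := ((hasDerivAt_pow 2 x).add_const 4).sqrt (by positivity)
    convert this using 1
    simp
    field_simp
  have h2 : HasDerivAt (fun x : ℝ => Real.exp (-x ^ 2 / 2)) (Real.exp (-x ^ 2 / 2) * (-x)) x := by
    have := ((hasDerivAt_pow 2 x).fun_neg.div_const 2).exp
    convert this using 1
    push_cast
    ring
  have h3 := (h2.fun_mul (h1.fun_sub (hasDerivAt_id' x))).div_const 2
  refine h3.congr_deriv ?_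
  field_simp
  ring

/-- With `s = √(x² + 4)` and `r = (s - x) / 2`, one has `r * (x + r) = 1` and `1 / s ≤ r`. Hence
minus the derivative of the candidate bound is at most the Gaussian integrand. -/
theorem sqrt_sub_mul_le (x : ℝ) :
    (Real.sqrt (x ^ 2 + 4) - x) / 2 * (x + 1 / Real.sqrt (x ^ 2 + 4)) ≤ 1 := by
  have hs : 0 < Real.sqrt (x ^ 2 + 4) := by positivity
  have hs2 : Real.sqrt (x ^ 2 + 4) ^ 2 = x ^ 2 + 4 := Real.sq_sqrt (by positivity)
  set s := Real.sqrt (x ^ 2 + 4)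
  have hxs : x * s ≤ x ^ 2 + 2 := by nlinarith [sq_nonneg (s - x)]
  have hlt : 0 ≤ s - x := by
    by_contra h
    push Not at h
    nlinarith
  have h1 : 1 / s ≤ (s - x) / 2 := by
    rw [div_le_div_iff₀ hs two_pos]
    nlinarith
  calc (s - x) / 2 * (x + 1 / s) ≤ (s - x) / 2 * (x + (s - x) / 2) := by gcongr
    _ = 1 := by nlinarith

theorem tendsto_exp_mul_sqrt_sub :
    Filter.Tendsto (fun x : ℝ => Real.exp (-x ^ 2 / 2) * (Real.sqrt (x ^ 2 + 4) - x) / 2)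
      Filter.atTop (nhds 0) := by
  have h1 : Filter.Tendsto (fun x : ℝ => Real.exp (-x ^ 2 / 2)) Filter.atTop (nhds 0) := by
    refine Real.tendsto_exp_atBot.comp ?_
    have : Filter.Tendsto (fun x : ℝ => x ^ 2 / 2) Filter.atTop Filter.atTop :=
      (Filter.tendsto_pow_atTop two_ne_zero).atTop_div_const two_pos
    simp_rw [neg_div]
    exact Filter.tendsto_neg_atTop_atBot.comp this
  refine squeeze_zero' ?_ ?_ h1
  · refine Filter.Eventually.of_forall fun x => ?_
    have : x ≤ Real.sqrt (x ^ 2 + 4) := Real.le_sqrt_of_sq_le (by linarith)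
    have : 0 ≤ Real.sqrt (x ^ 2 + 4) - x := by linarith
    positivity
  · filter_upwards [Filter.eventually_ge_atTop 0] with x hx
    have : Real.sqrt (x ^ 2 + 4) ≤ x + 2 := Real.sqrt_le_iff.2 ⟨by linarith, by nlinarith⟩
    have h := Real.exp_pos (-x ^ 2 / 2)
    nlinarith

theorem integral_exp_neg_sq_div_two_ge {c : ℝ} (hc : 0 ≤ c) :
    Real.exp (-c ^ 2 / 2) * (Real.sqrt (c ^ 2 + 4) - c) / 2
      ≤ ∫ x in Set.Ioi c, Real.exp (-x ^ 2 / 2) := by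
  have hneg : ∀ x ∈ Set.Ioi c, -(Real.exp (-x ^ 2 / 2) * ((Real.sqrt (x ^ 2 + 4) - x) / 2)
        * (x + 1 / Real.sqrt (x ^ 2 + 4))) ≤ 0 := by
    intro x hx
    have hx0 : 0 ≤ x := hc.trans (le_of_lt hx)
    have : x ≤ Real.sqrt (x ^ 2 + 4) := Real.le_sqrt_of_sq_le (by linarith)
    have : 0 ≤ Real.sqrt (x ^ 2 + 4) - x := by linarith
    rw [neg_nonpos]
    positivity
  have hint := integrableOn_Ioi_deriv_of_nonpos' (fun x _ => hasDerivAt_exp_mul_sqrt_sub x) hneg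
    tendsto_exp_mul_sqrt_sub
  have heq := integral_Ioi_of_hasDerivAt_of_nonpos' (fun x _ => hasDerivAt_exp_mul_sqrt_sub x) hneg
    tendsto_exp_mul_sqrt_sub
  have hg : IntegrableOn (fun x : ℝ => Real.exp (-x ^ 2 / 2)) (Set.Ioi c) := by
    have := (integrable_exp_neg_mul_sq (b := 1 / 2) (by norm_num)).integrableOn (s := Set.Ioi c)
    refine this.congr_fun (fun x _ => ?_) measurableSet_Ioi
    simp only
    congr 1
    ring
  have hle := setIntegral_mono_on hint.neg hg measurableSet_Ioi (fun x _ => by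
    have h1 := sqrt_sub_mul_le x
    have h2 := Real.exp_pos (-x ^ 2 / 2)
    simp only [Pi.neg_apply, neg_neg]
    nlinarith)
  simp only [Pi.neg_apply] at hle
  rw [integral_neg, heq] at hle
  linarith

/-- **Birnbaum's inequality** for the tail of the standard normal law. -/
theorem birnbaum_gaussianReal_Ioi {c : ℝ} (hc : 0 ≤ c) :
    Real.sqrt (2 / Real.pi) * (Real.exp (-c ^ 2 / 2) / (c + Real.sqrt (c ^ 2 + 4)))
      ≤ (gaussianReal 0 1).real (Set.Ioi c) := by
  have h1 : (gaussianReal 0 1).real (Set.Ioi c)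
      = (Real.sqrt (2 * Real.pi))⁻¹ * ∫ x in Set.Ioi c, Real.exp (-x ^ 2 / 2) := by
    rw [Measure.real, gaussianReal_apply_eq_integral 0 one_ne_zero, ENNReal.toReal_ofReal
      (integral_nonneg fun x => gaussianPDFReal_nonneg _ _ _), ← integral_const_mul]
    simp [gaussianPDFReal]
  have hs : 0 < Real.sqrt (c ^ 2 + 4) := by positivity
  have hs2 : Real.sqrt (c ^ 2 + 4) ^ 2 = c ^ 2 + 4 := Real.sq_sqrt (by positivity)
  have h2 : Real.sqrt (2 / Real.pi) = (Real.sqrt (2 * Real.pi))⁻¹ * 2 := by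
    rw [Real.sqrt_div (by norm_num), Real.sqrt_mul (by norm_num)]
    have : Real.sqrt Real.pi ≠ 0 := by positivity
    field_simp
    norm_num
  -- Rationalization: `(s - c) * (s + c) = 4` for `s = √(c² + 4)`.
  have h3 : Real.exp (-c ^ 2 / 2) / (c + Real.sqrt (c ^ 2 + 4))
      = Real.exp (-c ^ 2 / 2) * (Real.sqrt (c ^ 2 + 4) - c) / 4 := by
    rw [div_eq_div_iff (by positivity) (by norm_num)]
    linear_combination (-Real.exp (-c ^ 2 / 2)) * hs2
  rw [h1, h2, h3, mul_assoc]
  refine mul_le_mul_of_nonneg_left ?_ (by positivity)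
  linarith [integral_exp_neg_sq_div_two_ge hc]

theorem birnbaum_gaussianReal_Ici {v : ℝ≥0} (hv : v ≠ 0) {c : ℝ} (hc : 0 ≤ c) :
    Real.sqrt (2 / Real.pi) * (Real.sqrt v * Real.exp (-c ^ 2 / (2 * v))
        / (c + Real.sqrt (c ^ 2 + 4 * v)))
      ≤ (gaussianReal 0 v).real (Set.Ici c) := by
  have hv0 : (0 : ℝ) < v := by positivity
  have hs : 0 < Real.sqrt v := by positivity
  have hs2 : Real.sqrt v ^ 2 = v := Real.sq_sqrt hv0.le
  have hmap : gaussianReal 0 v = (gaussianReal 0 1).map (Real.sqrt v * ·) := by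
    rw [gaussianReal_map_const_mul]
    congr 1
    · simp
    · ext; simp
  have hpre : (Real.sqrt v * ·) ⁻¹' Set.Ici c = Set.Ici (c / Real.sqrt v) := by
    ext x
    simp [div_le_iff₀' hs]
  rw [hmap, map_measureReal_apply (by fun_prop) measurableSet_Ici, hpre]
  have h := (birnbaum_gaussianReal_Ioi (div_nonneg hc hs.le)).trans
    (measureReal_mono (Set.Ioi_subset_Ici_self))
  refine le_of_eq_of_le ?_ h
  congr 1
  have h1 : (c / Real.sqrt v) ^ 2 = c ^ 2 / v := by rw [div_pow, hs2]
  have h2 : Real.sqrt ((c / Real.sqrt v) ^ 2 + 4) = Real.sqrt (c ^ 2 + 4 * v) / Real.sqrt v := by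
    rw [← Real.sqrt_div (by positivity), h1]
    congr 1
    field_simp
  rw [h2, neg_div, neg_div, h1, ← add_div, div_div, mul_comm (v : ℝ) 2]
  field_simp

/-! ### Laws of the noise functionals. -/

theorem map_inner_stdGaussian {m : ℕ} (q : EuclideanSpace ℝ (Fin m)) :
    (stdGaussian (EuclideanSpace ℝ (Fin m))).map (fun x => inner ℝ q x)
      = gaussianReal 0 (‖q‖₊ ^ 2) := by
  have h := IsGaussian.map_eq_gaussianReal (μ := stdGaussian (EuclideanSpace ℝ (Fin m)))
    (innerSL ℝ q)
  rwa [integral_strongDual_stdGaussian, variance_dual_stdGaussian, innerSL_apply_norm,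
    Real.toNNReal_pow (norm_nonneg q), norm_toNNReal] at h

/-- A linear functional of the difference of two independent standard Gaussian vectors is Gaussian. -/
theorem hasLaw_inner_sub {Ω : Type*} [MeasurableSpace Ω] {P : Measure Ω} {m : ℕ}
    (q : EuclideanSpace ℝ (Fin m)) {X Y : Ω → EuclideanSpace ℝ (Fin m)}
    (hX : HasLaw X (stdGaussian (EuclideanSpace ℝ (Fin m))) P)
    (hY : HasLaw Y (stdGaussian (EuclideanSpace ℝ (Fin m))) P) (hXY : IndepFun X Y P) :
    HasLaw (fun ω => inner ℝ q (X ω - Y ω)) (gaussianReal 0 (2 * ‖q‖₊ ^ 2)) P := by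
  have hq : HasLaw (fun x : EuclideanSpace ℝ (Fin m) => inner ℝ q x)
      (gaussianReal 0 (‖q‖₊ ^ 2)) (stdGaussian (EuclideanSpace ℝ (Fin m))) :=
    ⟨by fun_prop, map_inner_stdGaussian q⟩
  have h1 := hq.fun_comp hX
  have h2 := gaussianReal_neg (hq.fun_comp hY)
  have hind : IndepFun (fun ω => inner ℝ q (X ω)) (-fun ω => inner ℝ q (Y ω)) P :=
    hXY.comp (φ := fun x => inner ℝ q x) (ψ := fun x => -inner ℝ q x) (by fun_prop) (by fun_prop)
  have h := gaussianReal_add_gaussianReal_of_indepFun hind h1.map_eq h2.map_eq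
  have hfun : (fun ω => inner ℝ q (X ω - Y ω))
      = (fun ω => inner ℝ q (X ω)) + (-fun ω => inner ℝ q (Y ω)) := by
    ext ω
    exact (inner_sub_right _ _ _).trans (sub_eq_add_neg _ _)
  rw [hfun]
  refine ⟨h1.aemeasurable.add h2.aemeasurable, ?_⟩
  rw [h]
  congr 1
  · simp
  · ring

theorem hasLaw_ofLp {Ω : Type*} [MeasurableSpace Ω] {P : Measure Ω} {m : ℕ}
    {X : Ω → EuclideanSpace ℝ (Fin m)}
    (hX : HasLaw X (stdGaussian (EuclideanSpace ℝ (Fin m))) P) :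
    HasLaw (fun ω => WithLp.ofLp (X ω)) (Measure.pi fun _ => gaussianReal 0 1) P := by
  have h : HasLaw (fun x : EuclideanSpace ℝ (Fin m) => WithLp.ofLp x)
      (Measure.pi fun _ => gaussianReal 0 1) (stdGaussian (EuclideanSpace ℝ (Fin m))) := by
    refine ⟨by fun_prop, ?_⟩
    rw [← map_pi_eq_stdGaussian, Measure.map_map (by fun_prop) (by fun_prop)]
    exact Measure.map_id
  exact h.fun_comp hX

/-! ### Negative dependence of the tail events. -/

open Classical in
/-- For nonnegative directions `q t` and a permutation `σ` without fixed points, the lower tail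
events of `∑ i, q t i * (x t i - x (σ t) i)` are negatively dependent. -/
theorem measure_pi_iInter_le_prod {T m : ℕ} {μ : Measure (Fin m → ℝ)} [IsProbabilityMeasure μ]
    (hμ : HarrisInequality μ) (q : Fin T → Fin m → ℝ) (hq : ∀ t i, 0 ≤ q t i)
    (σ : Equiv.Perm (Fin T)) (hσ : ∀ t, σ t ≠ t) (c : ℝ) :
    (Measure.pi fun _ : Fin T => μ) (⋂ t, {x | ∑ i, q t i * (x t i - x (σ t) i) < c})
      ≤ ∏ t, (Measure.pi fun _ : Fin T => μ) {x | ∑ i, q t i * (x t i - x (σ t) i) < c} := by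
  set S : Fin T → Set (Fin T → Fin m → ℝ) :=
    fun t => {x | ∑ i, q t i * (x t i - x (σ t) i) < c} with hS
  have hSm : ∀ t, MeasurableSet (S t) := fun t =>
    measurableSet_lt (by fun_prop) measurable_const
  have hσ' : ∀ t, t ≠ σ.symm t := fun t h => hσ t (by conv_lhs => rw [h, σ.apply_symm_apply])
  have hind : ∀ {x y : Fin T → Fin m → ℝ} {t}, (x ∈ S t → y ∈ S t) →
      (S t).indicator (1 : (Fin T → Fin m → ℝ) → ℝ≥0∞) x ≤ (S t).indicator 1 y := by
    intro x y t h
    by_cases hx : x ∈ S t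
    · simp [hx, h hx]
    · simp [hx]
  -- A "coordinate" here is a whole vector `x t`, ordered componentwise; it enters `S t` with a plus
  -- sign and `S (σ.symm t)` with a minus sign.
  have h := hμ.lintegral_pi_prod_le (fun t => (S t).indicator 1)
    (fun t => measurable_one.indicator (hSm t)) id σ.symm hσ' ?_ ?_ ?_
  · simp_rw [fun t => lintegral_indicator_one (μ := Measure.pi fun _ : Fin T => μ) (hSm t)] at h
    refine le_of_eq_of_le ?_ h
    rw [← lintegral_indicator_one (MeasurableSet.iInter hSm)]
    refine lintegral_congr fun x => ?_
    by_cases hx : ∀ t, x ∈ S t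
    · simp [hx]
    · obtain ⟨t, ht⟩ := not_forall.1 hx
      rw [Set.indicator_of_notMem (by simpa using hx),
        Finset.prod_eq_zero (Finset.mem_univ t) (by simp [ht])]
  · intro t x a b hab
    refine hind fun hx => ?_
    rw [hS, Set.mem_ofPred_eq] at hx ⊢
    refine lt_of_le_of_lt (Finset.sum_le_sum fun i _ => ?_) hx
    simp only [id, Function.update_self, Function.update_of_ne (hσ t)]
    have := hq t i
    have := hab i
    gcongr
  · intro t x a b hab
    refine hind fun hx => ?_
    rw [hS, Set.mem_ofPred_eq] at hx ⊢
    refine lt_of_le_of_lt (Finset.sum_le_sum fun i _ => ?_) hx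
    simp only [Equiv.apply_symm_apply, Function.update_self, Function.update_of_ne (hσ' t).symm]
    have := hq (σ.symm t) i
    have := hab i
    gcongr
  · intro t k h1 h2 x a
    have h3 : σ k ≠ t := fun h => h2 (by rw [← h, σ.symm_apply_apply])
    have h4 : k ≠ t := h1
    have : Function.update x t a ∈ S k ↔ x ∈ S k := by
      simp [hS, Function.update_of_ne h4, Function.update_of_ne h3]
    simp [Set.indicator, this]

/-- Negative dependence of the lower tail events of `⟪q t, w t - w (σ t)⟫`. -/
theorem measureReal_iInter_inner_lt_le_prod {Ω : Type*} [MeasurableSpace Ω] {P : Measure Ω}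
    [IsProbabilityMeasure P] {T m : ℕ} (q : Fin T → EuclideanSpace ℝ (Fin m))
    (hq : ∀ t i, 0 ≤ q t i) {w : Fin T → Ω → EuclideanSpace ℝ (Fin m)}
    (hw_law : ∀ t, HasLaw (w t) (stdGaussian (EuclideanSpace ℝ (Fin m))) P)
    (hw_indep : iIndepFun w P) (σ : Equiv.Perm (Fin T)) (hσ : ∀ t, σ t ≠ t) (c : ℝ) :
    P.real (⋂ t, {ω | inner ℝ (q t) (w t ω - w (σ t) ω) < c})
      ≤ ∏ t, P.real {ω | inner ℝ (q t) (w t ω - w (σ t) ω) < c} := by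
  have hlaw : HasLaw (fun ω t => WithLp.ofLp (w t ω))
      (Measure.pi fun _ : Fin T => Measure.pi fun _ : Fin m => gaussianReal 0 1) P :=
    (hw_indep.comp (fun _ x => WithLp.ofLp x) (fun _ => by fun_prop)).hasLaw_pi
      fun t => hasLaw_ofLp (hw_law t)
  have hinner : ∀ t ω, inner ℝ (q t) (w t ω - w (σ t) ω)
      = ∑ i, q t i * (w t ω i - w (σ t) ω i) := by
    intro t ω
    simp [PiLp.inner_apply, mul_comm]
  have hmeas : ∀ t, MeasurableSet
      {x : Fin T → Fin m → ℝ | ∑ i, q t i * (x t i - x (σ t) i) < c} := fun t =>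
    measurableSet_lt (by fun_prop) measurable_const
  -- Association is used at two levels: Chebyshev on `ℝ` gives Harris for one noise vector, which
  -- then feeds the product over the `T` vectors.
  have h := measure_pi_iInter_le_prod
    ((harrisInequality_of_linearOrder (gaussianReal 0 1)).pi m)
    (fun t i => q t i) hq σ hσ c
  have hP : ∀ t, P {ω | inner ℝ (q t) (w t ω - w (σ t) ω) < c}
      = (Measure.pi fun _ : Fin T => Measure.pi fun _ : Fin m => gaussianReal 0 1)
        {x | ∑ i, q t i * (x t i - x (σ t) i) < c} := by
    intro t
    simp_rw [hinner]
    exact hlaw.measure_eq (hmeas t)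
  have hPi : P (⋂ t, {ω | inner ℝ (q t) (w t ω - w (σ t) ω) < c})
      = (Measure.pi fun _ : Fin T => Measure.pi fun _ : Fin m => gaussianReal 0 1)
        (⋂ t, {x | ∑ i, q t i * (x t i - x (σ t) i) < c}) := by
    simp_rw [hinner]
    have := hlaw.measure_eq (p := fun x => ∀ t, ∑ i, q t i * (x t i - x (σ t) i) < c)
      (by simpa only [Set.ofPred_forall] using MeasurableSet.iInter hmeas)
    simpa only [Set.ofPred_forall] using this
  simp only [Measure.real, ← ENNReal.toReal_prod]
  refine ENNReal.toReal_mono (ENNReal.prod_ne_top fun t _ => measure_ne_top _ _) ?_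
  rw [hPi, Finset.prod_congr rfl fun t _ => hP t]
  exact h

/-! ### Assembly of the bound. -/

theorem exists_perm_forall_ne {T : ℕ} (hT : 2 ≤ T) : ∃ σ : Equiv.Perm (Fin T), ∀ t, σ t ≠ t := by
  obtain ⟨n, rfl⟩ := Nat.exists_eq_add_of_le' hT
  refine ⟨finRotate (n + 2), fun t => ?_⟩
  rw [finRotate_apply]
  simp

theorem theorem3 {Ω : Type*} [MeasurableSpace Ω] (P : Measure Ω) [IsProbabilityMeasure P]
    {T m : ℕ} (hT : 2 ≤ T)
    (p : Fin T → EuclideanSpace ℝ (Fin m))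
    (hp_nonneg : ∀ t i, 0 ≤ p t i) (hp_ne : ∀ t, p t ≠ 0)
    (w : Fin T → Ω → EuclideanSpace ℝ (Fin m))
    (hw_law : ∀ t, HasLaw (w t) (stdGaussian (EuclideanSpace ℝ (Fin m))) P)
    (hw_indep : iIndepFun w P)
    (y : Fin T → EuclideanSpace ℝ (Fin m)) :
    1 - ∏ t, (1 - Real.sqrt (2 / Real.pi) *
        (Real.sqrt (2 * ‖p t‖ ^ 2) *
            Real.exp (-(RevealedPreference.testStatistic p y) ^ 2 / (4 * ‖p t‖ ^ 2)) /
          (RevealedPreference.testStatistic p y +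
            Real.sqrt ((RevealedPreference.testStatistic p y) ^ 2 + 8 * ‖p t‖ ^ 2))))
      ≤ RevealedPreference.falseAlarmProb P p w y := by
  set c := RevealedPreference.testStatistic p y
  have hc : 0 ≤ c := (RevealedPreference.isGLB_testStatistic p y).2 fun Φ h => h.1
  obtain ⟨σ, hσ⟩ := exists_perm_forall_ne hT
  have hlaw : ∀ t, HasLaw (fun ω => inner ℝ (p t) (w t ω - w (σ t) ω))
      (gaussianReal 0 (2 * ‖p t‖₊ ^ 2)) P := fun t =>
    hasLaw_inner_sub (p t) (hw_law t) (hw_law (σ t)) (hw_indep.indepFun (hσ t).symm)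
  set S : Fin T → Set Ω := fun t => {ω | inner ℝ (p t) (w t ω - w (σ t) ω) < c} with hS
  -- The `w t` are only a.e. measurable, so the events are only null measurable.
  have hSm : ∀ t, NullMeasurableSet (S t) P := fun t =>
    (hlaw t).aemeasurable.nullMeasurable measurableSet_Iio
  have hfactor : ∀ t, P.real (S t) ≤ 1 - Real.sqrt (2 / Real.pi) *
      (Real.sqrt (2 * ‖p t‖ ^ 2) * Real.exp (-c ^ 2 / (4 * ‖p t‖ ^ 2)) /
        (c + Real.sqrt (c ^ 2 + 8 * ‖p t‖ ^ 2))) := by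
    intro t
    have hv : (2 * ‖p t‖₊ ^ 2 : ℝ≥0) ≠ 0 := by simp [hp_ne t]
    have h1 := birnbaum_gaussianReal_Ici hv hc
    have h2 : P.real (S t)ᶜ = (gaussianReal 0 (2 * ‖p t‖₊ ^ 2)).real (Set.Ici c) := by
      have h := (hlaw t).measureReal_eq (p := fun r => c ≤ r) measurableSet_Ici
      refine Eq.trans (congrArg P.real ?_) h
      ext ω
      simp [hS]
    rw [probReal_compl_eq_one_sub₀ (hSm t)] at h2
    have h3 : ((2 * ‖p t‖₊ ^ 2 : ℝ≥0) : ℝ) = 2 * ‖p t‖ ^ 2 := by simp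
    -- The variance `v = 2‖p t‖²` turns `2v` and `4v` into `4‖p t‖²` and `8‖p t‖²`.
    rw [← h2, h3, ← mul_assoc 2, ← mul_assoc 4] at h1
    norm_num at h1 ⊢
    linarith
  have hsub : (⋂ t, S t)ᶜ ⊆ {ω | c ≤ RevealedPreference.maxNoise p (fun t => w t ω)} := by
    intro ω hω
    simp only [hS, Set.mem_compl_iff, Set.mem_iInter, Set.mem_ofPred_eq, not_forall, not_lt] at hω
    obtain ⟨t, ht⟩ := hω
    exact ht.trans ((RevealedPreference.isGreatest_maxNoise hT p _).2
      ⟨t, σ t, (hσ t).symm, rfl⟩)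
  calc _ ≤ 1 - ∏ t, P.real (S t) := by
        gcongr with t
        exact hfactor t
    _ ≤ 1 - P.real (⋂ t, S t) := by
        gcongr
        exact measureReal_iInter_inner_lt_le_prod p hp_nonneg hw_law hw_indep σ hσ c
    _ = P.real (⋂ t, S t)ᶜ := (probReal_compl_eq_one_sub₀ (NullMeasurableSet.iInter hSm)).symm
    _ ≤ RevealedPreference.falseAlarmProb P p w y := measureReal_mono hsub
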